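/- Let $G$ be a second-countable, locally compact (Hausdorff), non-compact group with a left Haar measure $\mu$, let $S\subset G$, $1\le p<+\infty$, and let $\Gamma\subset\mathbb{C}$ be such that $\Gamma\setminus\{0\}\neq\emptyset$. Let $\omega:G\to(0,+\infty)$ be a weight which is locally $p$-integrable (that is, $\omega^p$ is locally $\mu$-integrable) and $S$-admissible (that is, $\operatorname{ess\,sup}_{t\in G}\omega(st)/\omega(t)<+\infty$ for every $s\in S$). Let $L^p(G,\omega)$ be the space of (classes of) measurable functions $f:G\to\mathbb{C}$ with $\|f\|_{p,\omega}:=\big(\int_G|f|^p\omega^p\,d\mu\big)^{1/p}<+\infty$, and for $s\in G$ put $(T_sf)(t)=f(s^{-1}t)$. For $\Delta\subset\mathbb{C}$, a vector $f\in L^p(G,\omega)$ is called $(\Delta,S)$-dense if $\{\lambda T_sf:\lambda\in\Delta,\ s\in S\}$ is dense in $L^p(G,\omega)$. Suppose that $\omega$ is continuous and that for every $s\in G$ $$M(s):=\sup_{t\in G}\frac{\omega(st)}{\omega(t)}<+\infty\quad\text{and}\quad R(s):=\sup_{t\in G}\frac{\omega(ts)}{\omega(t)}<+\infty.$$ Then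 the following hold (with the convention $\inf\emptyset=+\infty$): 1. If $\Gamma\setminus\{0\}$ is bounded and bounded away from zero, then there is a $(\Gamma,S)$-dense vector in $L^p(G,\omega)$ if and only if $\inf_{s\in S}\max\{\omega(s),\omega(s^{-1})\}=0$. 2. There is a $([0,1],S)$-dense vector in $L^p(G,\omega)$ if and only if $\inf_{s\in S}\max\{\omega(s)\omega(s^{-1}),\omega(s^{-1})\}=0$. 3. There is a $([1,+\infty),S)$-dense vector in $L^p(G,\omega)$ if and only if $\inf_{s\in S}\max\{\omega(s)\omega(s^{-1}),\omega(s)\}=0$. 4. There is a $(\mathbb{C},S)$-dense vector in $L^p(G,\omega)$ if and only if $\inf_{s\in S}\omega(s)\omega(s^{-1})=0$. -/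

import Mathlib

open MeasureTheory
open scoped ENNReal

/-- The measure `ω ^ p dμ`, so that `Lp ℂ p (weightedMeasure μ ω p)` is the weighted space
`L^p(G, ω)`, with norm `(∫ |f| ^ p ω ^ p dμ) ^ (1 / p)` (here `1 ≤ p < ∞`). -/
noncomputable def weightedMeasure {G : Type*} [MeasurableSpace G] (μ : Measure G) (ω : G → ℝ)
    (p : ℝ≥0∞) : Measure G :=
  μ.withDensity (fun t => ENNReal.ofReal (ω t) ^ p.toReal)

/-- The weighted space `L^p(G, ω)`. -/
noncomputable abbrev WeightedLp {G : Type*} [MeasurableSpace G] (μ : Measure G) (ω : G → ℝ)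
    (p : ℝ≥0∞) : Type _ :=
  Lp ℂ p (weightedMeasure μ ω p)

/-- Left translation of functions, `(T_s f)(t) = f (s⁻¹ t)`. -/
def leftTranslate {G : Type*} [Group G] (s : G) (f : G → ℂ) : G → ℂ :=
  fun t => f (s⁻¹ * t)

/-- `ω` is a locally `p`-integrable weight: positive, with `ω ^ p` locally integrable. -/
structure IsWeight {G : Type*} [TopologicalSpace G] [MeasurableSpace G] (μ : Measure G)
    (ω : G → ℝ) (p : ℝ≥0∞) : Prop where
  pos : ∀ t, 0 < ω t
  locallyIntegrable : LocallyIntegrable (fun t => ω t ^ p.toReal) μ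

/-- `ω` is `S`-admissible: `ess sup_t ω(st) / ω(t) < ∞` for all `s ∈ S`. -/
def IsAdmissibleWeight {G : Type*} [Group G] [MeasurableSpace G] (μ : Measure G)
    (S : Set G) (ω : G → ℝ) : Prop :=
  ∀ s ∈ S, essSup (fun t => ENNReal.ofReal (ω (s * t) / ω t)) μ < ∞

/-- The orbit `{λ T_s f : λ ∈ Γ, s ∈ S}`, as a set of elements of `L^p(G, ω)`. -/
def translateOrbit {G : Type*} [Group G] [MeasurableSpace G] (μ : Measure G) (ω : G → ℝ)
    (p : ℝ≥0∞) (Γ : Set ℂ) (S : Set G) (f : WeightedLp μ ω p) : Set (WeightedLp μ ω p) :=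
  {h | ∃ c ∈ Γ, ∃ s ∈ S, (h : G → ℂ) =ᵐ[weightedMeasure μ ω p] c • leftTranslate s (f : G → ℂ)}

/-- There is a `(Γ, S)`-dense vector in `L^p(G, ω)`. -/
def HasDenseVector {G : Type*} [Group G] [MeasurableSpace G] (μ : Measure G) (ω : G → ℝ)
    (p : ℝ≥0∞) [Fact (1 ≤ p)] (Γ : Set ℂ) (S : Set G) : Prop :=
  ∃ f : WeightedLp μ ω p, Dense (translateOrbit μ ω p Γ S f)

/-! All four statements reduce to one criterion, `hasDenseVector_iff`: a dense vector exists iff for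
every δ > 0 some s ∈ S and nonzero c ∈ Γ satisfy |c| ω(s) < δ and ω(s⁻¹) < δ|c|. What remains is to
decide when the constraint on Γ leaves room for |c| between ω(s⁻¹)/δ and δ/ω(s).

The criterion rests on `exists_weight_mul_comparable`: for u supported in a compact set, ‖T_s u‖ is
comparable to ω(s)‖u‖, with constants independent of s.

Sufficiency is Birkhoff transitivity: for compactly supported u, v the vector u + c⁻¹ T_{s⁻¹} v is
close to u, and c T_s sends it close to v.

Necessity: let f be dense and let u be its restriction to a compact K. If c T_s f approximates u and
s is far out, then c T_s u lives on sK, away from K, so |c| ω(s) is small; and the part of T_s f on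
K comes from the tail of f, so only a large |c| / ω(s⁻¹) can recover u. Taking s far out is the
delicate point: a small bump w added to u far away excludes every s in a given compact set
(`exists_perturbation_forall_notMem`). This is where noncompactness enters. -/

open Set Filter Topology
open scoped Pointwise

set_option linter.unusedSectionVars false

/-! ### Local uniformity of the weight -/

section WeightGrowth

variable {G : Type*} [Group G] [TopologicalSpace G] [IsTopologicalGroup G]

/-- By Baire's theorem, the ratios `ω (t * s) / ω t`, if bounded for every `s`, are bounded
uniformly for `s` in a compact set. -/
lemma exists_mul_right_le_of_isCompact [BaireSpace G] {ω : G → ℝ} (hcont : Continuous ω)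
    (hpos : ∀ t, 0 < ω t) (hR : ∀ s : G, BddAbove (range fun t : G => ω (t * s) / ω t))
    {K : Set G} (hK : IsCompact K) :
    ∃ C : ℝ, 0 < C ∧ ∀ k ∈ K, ∀ t, ω (t * k) ≤ C * ω t := by
  have hbound : ∀ s, ∃ c : ℝ, 0 < c ∧ ∀ t, ω (t * s) ≤ c * ω t := fun s => by
    obtain ⟨c, hc⟩ := hR s
    have h : ∀ t, ω (t * s) ≤ c * ω t := fun t =>
      (div_le_iff₀ (hpos t)).1 (hc (mem_range_self t))
    exact ⟨c, pos_of_mul_pos_left ((hpos _).trans_le (h 1)) (hpos 1).le, h⟩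
  -- These closed sets cover G, so Baire gives a bound uniform near one point k₀.
  obtain ⟨n, k₀, hk₀⟩ : ∃ n : ℕ, (interior {k : G | ∀ t, ω (t * k) ≤ n * ω t}).Nonempty := by
    refine nonempty_interior_of_iUnion_of_closed (fun n => ?_) (eq_univ_of_forall fun s => ?_)
    · rw [ofPred_forall]
      exact isClosed_iInter fun t => isClosed_le (by fun_prop) (by fun_prop)
    · obtain ⟨c, -, hc⟩ := hbound s
      obtain ⟨n, hn⟩ := exists_nat_ge c
      exact mem_iUnion.2 ⟨n, fun t => (hc t).trans (by gcongr; exact (hpos t).le)⟩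
  refine hK.induction_on (p := fun K => ∃ C : ℝ, 0 < C ∧ ∀ k ∈ K, ∀ t, ω (t * k) ≤ C * ω t)
    ⟨1, one_pos, by simp⟩ (fun s t hst ⟨C, hC, h⟩ => ⟨C, hC, fun k hk => h k (hst hk)⟩) ?_ ?_
  · rintro s t ⟨C, hC, h⟩ ⟨D, hD, h'⟩
    refine ⟨C + D, by positivity, ?_⟩
    rintro k (hk | hk) t
    · nlinarith [h k hk t, mul_pos hD (hpos t)]
    · nlinarith [h' k hk t, mul_pos hC (hpos t)]
  · intro x _
    -- Writing y = (x k₀⁻¹)(k₀ x⁻¹ y) carries the bound near k₀ to a neighbourhood of x.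
    obtain ⟨c, hc, hxc⟩ := hbound (x * k₀⁻¹)
    have hmem : (fun y => k₀ * x⁻¹ * y) ⁻¹' interior {k : G | ∀ t, ω (t * k) ≤ n * ω t} ∈ 𝓝 x := by
      refine (isOpen_interior.preimage (by fun_prop)).mem_nhds ?_
      simpa using hk₀
    refine ⟨_, mem_nhdsWithin_of_mem_nhds hmem, (n + 1) * c, by positivity, fun y hy t => ?_⟩
    have h1 := interior_subset hy (t * (x * k₀⁻¹))
    have h2 := hxc t
    have h3 : t * (x * k₀⁻¹) * (k₀ * x⁻¹ * y) = t * y := by group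
    rw [h3] at h1
    have h4 := hpos t
    calc ω (t * y) ≤ n * ω (t * (x * k₀⁻¹)) := h1
      _ ≤ n * (c * ω t) := by gcongr
      _ ≤ (n + 1) * c * ω t := by nlinarith [mul_pos hc h4]

/-- Inversion exchanges the two sides, so the right-hand bound applies to t ↦ ω(t⁻¹) on K⁻¹. -/
lemma exists_mul_left_le_of_isCompact [BaireSpace G] {ω : G → ℝ} (hcont : Continuous ω)
    (hpos : ∀ t, 0 < ω t) (hM : ∀ s : G, BddAbove (range fun t : G => ω (s * t) / ω t))
    {K : Set G} (hK : IsCompact K) :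
    ∃ C : ℝ, 0 < C ∧ ∀ k ∈ K, ∀ t, ω (k * t) ≤ C * ω t := by
  obtain ⟨C, hC, h⟩ := exists_mul_right_le_of_isCompact (ω := fun t => ω t⁻¹) (by fun_prop)
    (fun t => hpos _) (fun s => by
      refine (hM s⁻¹).mono ?_
      rintro _ ⟨t, rfl⟩
      exact ⟨t⁻¹, by simp⟩) hK.inv
  exact ⟨C, hC, fun k hk t => by simpa using h k⁻¹ (inv_mem_inv.2 hk) t⁻¹⟩

/-- On a compact set, `ω (s * k)` is comparable to `ω s * ω k`, uniformly in `s`. -/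
lemma exists_weight_mul_comparable [BaireSpace G] {ω : G → ℝ} (hcont : Continuous ω)
    (hpos : ∀ t, 0 < ω t) (hR : ∀ s : G, BddAbove (range fun t : G => ω (t * s) / ω t))
    {K : Set G} (hK : IsCompact K) :
    ∃ B : ℝ, 0 < B ∧ ∀ s, ∀ k ∈ K, ω (s * k) ≤ B * ω s * ω k ∧ ω s * ω k ≤ B * ω (s * k) := by
  obtain ⟨A, hA, h⟩ := exists_mul_right_le_of_isCompact hcont hpos hR hK
  obtain ⟨A', hA', h'⟩ := exists_mul_right_le_of_isCompact hcont hpos hR hK.inv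
  have h1 : ∀ k ∈ K, ∀ t, ω t ≤ A' * ω (t * k) := fun k hk t => by
    simpa using h' k⁻¹ (inv_mem_inv.2 hk) (t * k)
  have e := hpos 1
  -- The first summand serves the upper bound, the second the lower one; ω(1) appears because ω(k)
  -- is compared with it.
  refine ⟨A * A' / ω 1 + A * A' * ω 1, by positivity, fun s k hk => ?_⟩
  have hs := hpos s
  have hk' := hpos k
  have hsk := hpos (s * k)
  have h2 : ω k ≤ A * ω 1 := by simpa using h k hk 1
  have h3 : ω 1 ≤ A' * ω k := by simpa using h1 k hk 1
  constructor
  · calc ω (s * k) ≤ A * ω s := h k hk s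
      _ = A / ω 1 * ω s * ω 1 := by field_simp
      _ ≤ A / ω 1 * ω s * (A' * ω k) := by gcongr
      _ = A * A' / ω 1 * ω s * ω k := by ring
      _ ≤ _ := by gcongr; exact le_add_of_nonneg_right (by positivity)
  · calc ω s * ω k ≤ (A' * ω (s * k)) * (A * ω 1) := by gcongr; exact h1 k hk s
      _ = A * A' * ω 1 * ω (s * k) := by ring
      _ ≤ _ := by gcongr; exact le_add_of_nonneg_left (by positivity)

end WeightGrowth

/-! ### The measure ω^p dμ -/

section WeightedMeasure

variable {G : Type*} [MeasurableSpace G] {μ : Measure G} {ω : G → ℝ} {p : ℝ≥0∞}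

lemma eLpNorm_weightedMeasure (hω : Measurable ω) (hp0 : p ≠ 0) (hp : p ≠ ∞) (f : G → ℂ) :
    eLpNorm f p (weightedMeasure μ ω p) =
      (∫⁻ t, (ENNReal.ofReal (ω t) * ‖f t‖ₑ) ^ p.toReal ∂μ) ^ (1 / p.toReal) := by
  rw [eLpNorm_eq_lintegral_rpow_enorm_toReal hp0 hp, weightedMeasure,
    lintegral_withDensity_eq_lintegral_mul_non_measurable _ (by fun_prop)
      (ae_of_all _ fun t => ENNReal.rpow_lt_top_of_nonneg ENNReal.toReal_nonneg
        ENNReal.ofReal_ne_top)]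
  simp [ENNReal.mul_rpow_of_nonneg]

lemma weightedMeasure_absolutelyContinuous : weightedMeasure μ ω p ≪ μ :=
  withDensity_absolutelyContinuous _ _

lemma absolutelyContinuous_weightedMeasure (hω : Measurable ω) (hpos : ∀ t, 0 < ω t) :
    μ ≪ weightedMeasure μ ω p :=
  withDensity_absolutelyContinuous' (by fun_prop) (ae_of_all _ fun t =>
    (ENNReal.rpow_pos (ENNReal.ofReal_pos.2 (hpos t)) ENNReal.ofReal_ne_top).ne')

lemma isLocallyFiniteMeasure_weightedMeasure [TopologicalSpace G] [OpensMeasurableSpace G]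
    [IsLocallyFiniteMeasure μ] (hω : Continuous ω) :
    IsLocallyFiniteMeasure (weightedMeasure μ ω p) := by
  have h : Continuous fun t => (ω t).toNNReal ^ p.toReal :=
    (NNReal.continuous_rpow_const ENNReal.toReal_nonneg).comp (by fun_prop)
  have e : weightedMeasure μ ω p =
      μ.withDensity (fun t => (((ω t).toNNReal ^ p.toReal : NNReal) : ℝ≥0∞)) := by
    simp only [weightedMeasure, ENNReal.coe_rpow_of_nonneg _ ENNReal.toReal_nonneg]
    rfl
  rw [e]
  exact IsLocallyFiniteMeasure.withDensity_coe h

end WeightedMeasure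

/-! ### Restriction and translation operators -/

section Operators

variable {G : Type*} [MeasurableSpace G] {μ : Measure G} {ω : G → ℝ} {p : ℝ≥0∞}

lemma MeasureTheory.norm_le_of_ae_eq_of_eLpNorm_le {ν : Measure G} {f g : Lp ℂ p ν} {φ ψ : G → ℂ}
    {c : ℝ} (hc : 0 ≤ c) (hf : f =ᵐ[ν] φ) (hg : g =ᵐ[ν] ψ)
    (h : eLpNorm φ p ν ≤ ENNReal.ofReal c * eLpNorm ψ p ν) : ‖f‖ ≤ c * ‖g‖ := by
  rw [← eLpNorm_congr_ae hf, ← eLpNorm_congr_ae hg] at h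
  rw [Lp.norm_def, Lp.norm_def, ← ENNReal.toReal_ofReal hc, ← ENNReal.toReal_mul]
  exact ENNReal.toReal_mono (ENNReal.mul_ne_top ENNReal.ofReal_ne_top (Lp.eLpNorm_ne_top g)) h

/-- The restriction `f ↦ 1_A f` on `L^p`, as a linear map. -/
noncomputable def lpRestrictLinear (ν : Measure G) (p : ℝ≥0∞) {A : Set G}
    (hA : MeasurableSet A) : Lp ℂ p ν →ₗ[ℂ] Lp ℂ p ν where
  toFun f := ((Lp.memLp f).indicator hA).toLp (A.indicator f)
  map_add' f g := by
    rw [← MemLp.toLp_add, MemLp.toLp_eq_toLp_iff]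
    filter_upwards [Lp.coeFn_add f g] with t ht
    by_cases h : t ∈ A
    · simpa only [Pi.add_apply, indicator_of_mem h] using ht
    · simp [h]
  map_smul' c f := by
    rw [RingHom.id_apply, ← MemLp.toLp_const_smul, MemLp.toLp_eq_toLp_iff]
    filter_upwards [Lp.coeFn_smul c f] with t ht
    by_cases h : t ∈ A
    · simpa only [Pi.smul_apply, indicator_of_mem h] using ht
    · simp [h]

lemma lpRestrictLinear_coeFn {ν : Measure G} {A : Set G} (hA : MeasurableSet A) (f : Lp ℂ p ν) :
    lpRestrictLinear ν p hA f =ᵐ[ν] A.indicator f := by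
  have h : lpRestrictLinear ν p hA f = ((Lp.memLp f).indicator hA).toLp (A.indicator f) := rfl
  rw [h]
  exact MemLp.coeFn_toLp _

lemma norm_lpRestrictLinear_le {ν : Measure G} {A : Set G} (hA : MeasurableSet A)
    (f : Lp ℂ p ν) : ‖lpRestrictLinear ν p hA f‖ ≤ 1 * ‖f‖ :=
  norm_le_of_ae_eq_of_eLpNorm_le zero_le_one (lpRestrictLinear_coeFn hA f) (ae_eq_refl _)
    (by simpa using eLpNorm_indicator_le (f : G → ℂ))

/-- The restriction operator `f ↦ 1_A f` on `L^p`. -/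
noncomputable def lpRestrict (ν : Measure G) (p : ℝ≥0∞) [Fact (1 ≤ p)] {A : Set G}
    (hA : MeasurableSet A) : Lp ℂ p ν →L[ℂ] Lp ℂ p ν :=
  (lpRestrictLinear ν p hA).mkContinuous 1 (norm_lpRestrictLinear_le hA)

section Restrict

variable {ν : Measure G} [Fact (1 ≤ p)] {A B : Set G}

lemma lpRestrict_coeFn (hA : MeasurableSet A) (f : Lp ℂ p ν) :
    lpRestrict ν p hA f =ᵐ[ν] A.indicator f :=
  lpRestrictLinear_coeFn hA f

lemma norm_lpRestrict_le (hA : MeasurableSet A) (f : Lp ℂ p ν) : ‖lpRestrict ν p hA f‖ ≤ ‖f‖ :=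
  (norm_lpRestrictLinear_le hA f).trans_eq (one_mul _)

lemma lpRestrict_lpRestrict_of_subset (hA : MeasurableSet A) (hB : MeasurableSet B) (h : A ⊆ B)
    (f : Lp ℂ p ν) : lpRestrict ν p hA (lpRestrict ν p hB f) = lpRestrict ν p hA f := by
  apply Lp.ext
  filter_upwards [lpRestrict_coeFn hA (lpRestrict ν p hB f), lpRestrict_coeFn hA f,
    lpRestrict_coeFn hB f] with t h1 h2 h3
  rw [h1, h2]
  by_cases ht : t ∈ A
  · simp [ht, h3, h ht]
  · simp [ht]

lemma norm_lpRestrict_mono (hA : MeasurableSet A) (hB : MeasurableSet B) (h : A ⊆ B)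
    (f : Lp ℂ p ν) : ‖lpRestrict ν p hA f‖ ≤ ‖lpRestrict ν p hB f‖ := by
  rw [← lpRestrict_lpRestrict_of_subset hA hB h]
  exact norm_lpRestrict_le _ _

lemma lpRestrict_lpRestrict_of_disjoint (hA : MeasurableSet A) (hB : MeasurableSet B)
    (h : Disjoint A B) (f : Lp ℂ p ν) : lpRestrict ν p hA (lpRestrict ν p hB f) = 0 := by
  apply Lp.ext
  filter_upwards [lpRestrict_coeFn hA (lpRestrict ν p hB f), lpRestrict_coeFn hB f,
    Lp.coeFn_zero ℂ p ν] with t h1 h2 h3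
  rw [h1, h3]
  by_cases ht : t ∈ A
  · simp [ht, h2, h.notMem_of_mem_left ht]
  · simp [ht]

lemma lpRestrict_add_lpRestrict_compl (hA : MeasurableSet A) (f : Lp ℂ p ν) :
    lpRestrict ν p hA f + lpRestrict ν p hA.compl f = f := by
  apply Lp.ext
  filter_upwards [Lp.coeFn_add (lpRestrict ν p hA f) (lpRestrict ν p hA.compl f),
    lpRestrict_coeFn hA f, lpRestrict_coeFn hA.compl f] with t h1 h2 h3
  rw [h1, Pi.add_apply, h2, h3]
  by_cases ht : t ∈ A <;> simp [ht]

lemma lpRestrict_univ (f : Lp ℂ p ν) : lpRestrict ν p MeasurableSet.univ f = f := by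
  apply Lp.ext
  filter_upwards [lpRestrict_coeFn MeasurableSet.univ f] with t ht
  simp [ht]

lemma norm_lpRestrict_le_of_disjoint (hA : MeasurableSet A)
    (hB : MeasurableSet B) (h : Disjoint A B) (f : Lp ℂ p ν) :
    ‖lpRestrict ν p hA f‖ ≤ ‖lpRestrict ν p hB.compl f‖ :=
  norm_lpRestrict_mono hA hB.compl (fun _ ht => h.notMem_of_mem_left ht) f

lemma exists_isCompact_norm_lpRestrict_compl_le [TopologicalSpace G] [T2Space G] [BorelSpace G]
    [NormalSpace G] [WeaklyLocallyCompactSpace G] [ν.Regular] (hp : p ≠ ∞) (f : Lp ℂ p ν) {ε : ℝ} (hε : 0 < ε) :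
    ∃ (K : Set G) (hK : IsCompact K), ‖lpRestrict ν p hK.measurableSet.compl f‖ ≤ ε := by
  obtain ⟨g, hg, hfg, -, -⟩ := (Lp.memLp f).exists_hasCompactSupport_eLpNorm_sub_le hp
    (ENNReal.ofReal_pos.2 hε).ne'
  -- Off the support of g one has f = f - g, so the tail of f is at most the approximation error.
  refine ⟨tsupport g, hg, ?_⟩
  rw [Lp.norm_def]
  refine ENNReal.toReal_le_of_le_ofReal hε.le (le_trans ?_ hfg)
  refine eLpNorm_mono_ae ?_
  filter_upwards [lpRestrict_coeFn hg.measurableSet.compl f] with t ht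
  rw [ht]
  by_cases h : t ∈ tsupport g
  · simp [h]
  · simp [h, image_eq_zero_of_notMem_tsupport h]

end Restrict

section Translate

variable [Group G] [MeasurableMul G]

/-- The substitution t ↦ st moves the translation onto the weight. The bound is needed only where f
≠ 0, which later allows constants tied to a compact support. -/
lemma eLpNorm_leftTranslate_le [μ.IsMulLeftInvariant] (hω : Measurable ω) (hpos : ∀ t, 0 < ω t)
    (hp0 : p ≠ 0) (hp : p ≠ ∞) {f : G → ℂ} {s : G} {c : ℝ}
    (h : ∀ t, f t ≠ 0 → ω (s * t) ≤ c * ω t) :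
    eLpNorm (leftTranslate s f) p (weightedMeasure μ ω p) ≤
      ENNReal.ofReal c * eLpNorm f p (weightedMeasure μ ω p) := by
  have hp' : 0 < p.toReal := ENNReal.toReal_pos hp0 hp
  rw [eLpNorm_weightedMeasure hω hp0 hp, eLpNorm_weightedMeasure hω hp0 hp,
    ← lintegral_mul_left_eq_self _ s]
  have e : ENNReal.ofReal c = (ENNReal.ofReal c ^ p.toReal) ^ (1 / p.toReal) := by
    rw [← ENNReal.rpow_mul, mul_one_div_cancel hp'.ne', ENNReal.rpow_one]
  rw [e, ← ENNReal.mul_rpow_of_nonneg _ _ (by positivity), ← lintegral_const_mul' _ _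
    (ENNReal.rpow_ne_top_of_nonneg hp'.le ENNReal.ofReal_ne_top)]
  gcongr with t
  rw [← ENNReal.mul_rpow_of_nonneg _ _ hp'.le]
  gcongr ?_ ^ _
  simp only [leftTranslate, inv_mul_cancel_left]
  by_cases ht : f t = 0
  · simp [ht]
  · rw [← mul_assoc, ← ENNReal.ofReal_mul' (hpos t).le]
    gcongr
    exact h t ht

lemma quasiMeasurePreserving_mul_left_weightedMeasure [μ.IsMulLeftInvariant]
    (hω : Measurable ω) (hpos : ∀ t, 0 < ω t) (s : G) :
    Measure.QuasiMeasurePreserving (fun t => s * t) (weightedMeasure μ ω p)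
      (weightedMeasure μ ω p) :=
  (measurePreserving_mul_left μ s).quasiMeasurePreserving.mono
    weightedMeasure_absolutelyContinuous (absolutelyContinuous_weightedMeasure hω hpos)

lemma leftTranslate_congr_ae [μ.IsMulLeftInvariant] (hω : Measurable ω) (hpos : ∀ t, 0 < ω t)
    (s : G) {f g : G → ℂ} (h : f =ᵐ[weightedMeasure μ ω p] g) :
    leftTranslate s f =ᵐ[weightedMeasure μ ω p] leftTranslate s g :=
  (quasiMeasurePreserving_mul_left_weightedMeasure hω hpos s⁻¹).ae_eq h

/-- Left translation acts as a bounded operator on the weighted space. -/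
lemma exists_translation [μ.IsMulLeftInvariant] [Fact (1 ≤ p)] (hp : p ≠ ∞) (hω : Measurable ω)
    (hpos : ∀ t, 0 < ω t) (hM : ∀ s : G, BddAbove (range fun t : G => ω (s * t) / ω t)) (s : G) :
    ∃ T : WeightedLp μ ω p →L[ℂ] WeightedLp μ ω p,
      ∀ f, T f =ᵐ[weightedMeasure μ ω p] leftTranslate s f := by
  have hp0 : p ≠ 0 := (zero_lt_one.trans_le Fact.out).ne'
  obtain ⟨c, hc⟩ := hM s
  have h : ∀ t, ω (s * t) ≤ c * ω t := fun t => (div_le_iff₀ (hpos t)).1 (hc (mem_range_self t))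
  have hc0 : 0 ≤ c := (pos_of_mul_pos_left ((hpos _).trans_le (h 1)) (hpos 1).le).le
  have hle : ∀ f : G → ℂ, eLpNorm (leftTranslate s f) p (weightedMeasure μ ω p) ≤
      ENNReal.ofReal c * eLpNorm f p (weightedMeasure μ ω p) := fun f =>
    eLpNorm_leftTranslate_le hω hpos hp0 hp fun t _ => h t
  have hmem : ∀ f : WeightedLp μ ω p, MemLp (leftTranslate s f) p (weightedMeasure μ ω p) :=
    fun f => ⟨(Lp.aestronglyMeasurable f).comp_quasiMeasurePreserving
      (quasiMeasurePreserving_mul_left_weightedMeasure hω hpos s⁻¹),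
      (hle f).trans_lt (ENNReal.mul_lt_top ENNReal.ofReal_lt_top (Lp.eLpNorm_lt_top f))⟩
  let T : WeightedLp μ ω p →ₗ[ℂ] WeightedLp μ ω p :=
    { toFun := fun f => (hmem f).toLp _
      map_add' := fun f g => by
        rw [← MemLp.toLp_add (hmem f) (hmem g), MemLp.toLp_eq_toLp_iff]
        have h : leftTranslate s (f + g : WeightedLp μ ω p) =ᵐ[weightedMeasure μ ω p]
            leftTranslate s (⇑f + ⇑g) := leftTranslate_congr_ae hω hpos s (Lp.coeFn_add f g)
        filter_upwards [h] with t ht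
        exact ht
      map_smul' := fun z f => by
        rw [RingHom.id_apply, ← MemLp.toLp_const_smul z (hmem f), MemLp.toLp_eq_toLp_iff]
        have h : leftTranslate s (z • f : WeightedLp μ ω p) =ᵐ[weightedMeasure μ ω p]
            leftTranslate s (z • ⇑f) := leftTranslate_congr_ae hω hpos s (Lp.coeFn_smul z f)
        filter_upwards [h] with t ht
        exact ht }
  have hT : ∀ f, T f =ᵐ[weightedMeasure μ ω p] leftTranslate s f := fun f =>
    MemLp.coeFn_toLp (hmem f)
  have hb : ∀ f, ‖T f‖ ≤ c * ‖f‖ := fun f =>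
    norm_le_of_ae_eq_of_eLpNorm_le hc0 (hT f) (ae_eq_refl _) (hle f)
  exact ⟨T.mkContinuous c hb, hT⟩

end Translate

end Operators

/-! ### Translations of restricted vectors -/

section TranslateNorm

variable {G : Type*} [MeasurableSpace G] [Group G] [MeasurableMul G] {μ : Measure G}
  [μ.IsMulLeftInvariant] {ω : G → ℝ} {p : ℝ≥0∞} [Fact (1 ≤ p)]
  {T : G → WeightedLp μ ω p →L[ℂ] WeightedLp μ ω p}

lemma translation_inv_apply (hω : Measurable ω) (hpos : ∀ t, 0 < ω t)
    (hT : ∀ s f, T s f =ᵐ[weightedMeasure μ ω p] leftTranslate s f) (s : G)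
    (f : WeightedLp μ ω p) : T s (T s⁻¹ f) = f := by
  apply Lp.ext
  refine (hT s (T s⁻¹ f)).trans ((leftTranslate_congr_ae hω hpos s (hT s⁻¹ f)).trans ?_)
  exact .of_forall fun t => by simp [leftTranslate]

lemma translation_lpRestrict (hω : Measurable ω) (hpos : ∀ t, 0 < ω t)
    (hT : ∀ s f, T s f =ᵐ[weightedMeasure μ ω p] leftTranslate s f) {s : G} {A B : Set G}
    (hA : MeasurableSet A) (hB : MeasurableSet B) (h : ∀ t, t ∈ A ↔ s * t ∈ B)
    (f : WeightedLp μ ω p) :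
    T s (lpRestrict _ p hA f) = lpRestrict _ p hB (T s f) := by
  apply Lp.ext
  refine (hT s _).trans ((leftTranslate_congr_ae hω hpos s (lpRestrict_coeFn hA f)).trans ?_)
  filter_upwards [lpRestrict_coeFn hB (T s f), hT s f] with t h1 h2
  have h3 := h (s⁻¹ * t)
  rw [mul_inv_cancel_left] at h3
  rw [h1, leftTranslate]
  by_cases ht : t ∈ B
  · rw [indicator_of_mem ht, h2, indicator_of_mem (h3.2 ht), leftTranslate]
  · rw [indicator_of_notMem ht, indicator_of_notMem (mt h3.1 ht)]

lemma norm_translation_lpRestrict_le (hp : p ≠ ∞) (hω : Measurable ω) (hpos : ∀ t, 0 < ω t)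
    (hT : ∀ s f, T s f =ᵐ[weightedMeasure μ ω p] leftTranslate s f) {s : G} {A : Set G}
    (hA : MeasurableSet A) {c : ℝ} (hc : 0 ≤ c) (h : ∀ t ∈ A, ω (s * t) ≤ c * ω t)
    (f : WeightedLp μ ω p) :
    ‖T s (lpRestrict _ p hA f)‖ ≤ c * ‖lpRestrict _ p hA f‖ := by
  have hp0 : p ≠ 0 := (zero_lt_one.trans_le Fact.out).ne'
  have hf := lpRestrict_coeFn hA f
  refine norm_le_of_ae_eq_of_eLpNorm_le hc
    ((hT s _).trans (leftTranslate_congr_ae hω hpos s hf)) hf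
    (eLpNorm_leftTranslate_le hω hpos hp0 hp fun t ht => h t ?_)
  by_contra h'
  exact ht (indicator_of_notMem h' _)

/-- This is the upper bound for T_{s⁻¹} on the set sA. -/
lemma norm_lpRestrict_le_norm_translation (hp : p ≠ ∞) (hω : Measurable ω) (hpos : ∀ t, 0 < ω t)
    (hT : ∀ s f, T s f =ᵐ[weightedMeasure μ ω p] leftTranslate s f) {s : G} {A : Set G}
    (hA : MeasurableSet A) {c : ℝ} (hc : 0 ≤ c) (h : ∀ t ∈ A, ω t ≤ c * ω (s * t))
    (f : WeightedLp μ ω p) :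
    ‖lpRestrict _ p hA f‖ ≤ c * ‖T s (lpRestrict _ p hA f)‖ := by
  have hB : MeasurableSet ((fun t => s⁻¹ * t) ⁻¹' A) := measurable_const_mul _ hA
  rw [translation_lpRestrict hω hpos hT hA hB (by simp)]
  convert norm_translation_lpRestrict_le hp hω hpos hT (s := s⁻¹) hB hc (fun t ht => ?_) (T s f)
    using 2
  · rw [← translation_lpRestrict hω hpos hT hA hB (by simp)]
    simpa using (translation_inv_apply hω hpos hT s⁻¹ (lpRestrict _ p hA f)).symm
  · simpa using h _ ht

lemma mem_translateOrbit_iff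
    (hT : ∀ s f, T s f =ᵐ[weightedMeasure μ ω p] leftTranslate s f) {Γ : Set ℂ} {S : Set G}
    {f h : WeightedLp μ ω p} :
    h ∈ translateOrbit μ ω p Γ S f ↔ ∃ c ∈ Γ, ∃ s ∈ S, h = c • T s f := by
  have : ∀ (c : ℂ) (s : G), h =ᵐ[weightedMeasure μ ω p] c • leftTranslate s f ↔ h = c • T s f := by
    intro c s
    have e : (c • T s f : WeightedLp μ ω p) =ᵐ[weightedMeasure μ ω p] c • leftTranslate s f :=
      (Lp.coeFn_smul c (T s f)).trans ((hT s f).const_smul c)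
    exact ⟨fun h' => Lp.ext (h'.trans e.symm), fun h' => by rw [h']; exact e⟩
  simp only [translateOrbit, mem_ofPred_eq, this]

end TranslateNorm

/-! ### Birkhoff transitivity -/

section Universality

/-- Birkhoff's transitivity criterion for a family of continuous maps on a Baire space. -/
lemma exists_dense_orbit_of_transitive {X ι : Type*} [TopologicalSpace X] [BaireSpace X] [Nonempty X]
    [SecondCountableTopology X] (Φ : ι → X → X) (hΦ : ∀ i, Continuous (Φ i))
    (h : ∀ U V : Set X, IsOpen U → IsOpen V → U.Nonempty → V.Nonempty →
      ∃ i, ∃ x ∈ U, Φ i x ∈ V) :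
    ∃ x, Dense (range fun i => Φ i x) := by
  obtain ⟨b, hbc, hbe, hb⟩ := TopologicalSpace.exists_countable_basis X
  have := hbc.to_subtype
  -- A point of this intersection has an orbit meeting every basic open set.
  have hd : Dense (⋂ V : b, ⋃ i, Φ i ⁻¹' (V : Set X)) := by
    refine dense_iInter_of_isOpen
      (fun V => isOpen_iUnion fun i => (hb.isOpen V.2).preimage (hΦ i)) fun V => ?_
    rw [dense_iff_inter_open]
    intro U hU hUne
    have hVne : (V : Set X).Nonempty := nonempty_iff_ne_empty.2 fun h => hbe (h ▸ V.2)
    obtain ⟨i, x, hx, hxV⟩ := h U V hU (hb.isOpen V.2) hUne hVne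
    exact ⟨x, hx, mem_iUnion.2 ⟨i, hxV⟩⟩
  obtain ⟨x, hx⟩ := hd.nonempty
  refine ⟨x, hb.dense_iff.2 fun V hV _ => ?_⟩
  obtain ⟨i, hi⟩ := mem_iUnion.1 (mem_iInter.1 hx ⟨V, hV⟩)
  exact ⟨_, hi, i, rfl⟩

end Universality

/-! ### Sufficiency of the criterion -/

section DenseVector

variable {G : Type*} [Group G] [TopologicalSpace G] [IsTopologicalGroup G]
    [T2Space G] [LocallyCompactSpace G] [SecondCountableTopology G]
    [MeasurableSpace G] [BorelSpace G] {μ : Measure G} [μ.IsHaarMeasure]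
    {p : ℝ≥0∞} [Fact (1 ≤ p)] {ω : G → ℝ} {S : Set G} {Γ : Set ℂ}

/-- G is metrizable and σ-compact, where locally finite Borel measures are regular. -/
lemma regular_weightedMeasure (hω : Continuous ω) : (weightedMeasure μ ω p).Regular := by
  have : IsLocallyFiniteMeasure (weightedMeasure μ ω p) :=
    isLocallyFiniteMeasure_weightedMeasure hω
  have := TopologicalSpace.metrizableSpace_of_t3_secondCountable G
  let _ := TopologicalSpace.metrizableSpaceMetric G
  infer_instance

lemma secondCountableTopology_weightedLp (hp : p ≠ ∞) (hω : Continuous ω) :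
    SecondCountableTopology (WeightedLp μ ω p) := by
  have : IsLocallyFiniteMeasure (weightedMeasure μ ω p) :=
    isLocallyFiniteMeasure_weightedMeasure hω
  have : Fact (p ≠ ∞) := ⟨hp⟩
  infer_instance

lemma nontrivial_weightedLp (hω : Continuous ω) (hpos : ∀ t, 0 < ω t) :
    Nontrivial (WeightedLp μ ω p) := by
  have : IsLocallyFiniteMeasure (weightedMeasure μ ω p) :=
    isLocallyFiniteMeasure_weightedMeasure hω
  obtain ⟨K, hK, h1⟩ := exists_compact_mem_nhds (1 : G)
  refine ⟨indicatorConstLp p hK.measurableSet hK.measure_lt_top.ne 1, 0, fun h => ?_⟩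
  have hpos' : weightedMeasure μ ω p K ≠ 0 := fun h0 =>
    (Measure.measure_pos_of_mem_nhds μ h1).ne'
      (absolutelyContinuous_weightedMeasure hω.measurable hpos h0)
  have hp0 : p ≠ 0 := (zero_lt_one.trans_le Fact.out).ne'
  have hnorm := norm_indicatorConstLp' (hs := hK.measurableSet) (hμs := hK.measure_lt_top.ne)
    (c := (1 : ℂ)) hp0 hpos'
  rw [h, norm_zero, norm_one, one_mul] at hnorm
  exact (Real.rpow_pos_of_pos (ENNReal.toReal_pos hpos' hK.measure_lt_top.ne) _).ne hnorm

lemma hasDenseVector_of_exists_small (hp : p ≠ ∞) (hω : Continuous ω) (hpos : ∀ t, 0 < ω t)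
    (hM : ∀ s : G, BddAbove (Set.range fun t : G => ω (s * t) / ω t))
    (hR : ∀ s : G, BddAbove (Set.range fun t : G => ω (t * s) / ω t))
    (h : ∀ δ > 0, ∃ s ∈ S, ∃ c ∈ Γ, c ≠ 0 ∧ ‖c‖ * ω s < δ ∧ ω s⁻¹ < δ * ‖c‖) :
    HasDenseVector μ ω p Γ S := by
  choose T hT using exists_translation (μ := μ) hp hω.measurable hpos hM
  have := secondCountableTopology_weightedLp (μ := μ) hp hω
  have := regular_weightedMeasure (μ := μ) (p := p) hω
  suffices htrans : ∀ U V : Set (WeightedLp μ ω p), IsOpen U → IsOpen V → U.Nonempty →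
      V.Nonempty → ∃ i : Γ × S, ∃ x ∈ U, (i.1 : ℂ) • T i.2 x ∈ V by
    obtain ⟨f, hf⟩ := exists_dense_orbit_of_transitive
      (fun (i : Γ × S) (f : WeightedLp μ ω p) => (i.1 : ℂ) • T i.2 f)
      (fun i => by fun_prop) htrans
    refine ⟨f, hf.mono ?_⟩
    rintro _ ⟨⟨c, s⟩, rfl⟩
    exact (mem_translateOrbit_iff hT).2 ⟨c, c.2, s, s.2, rfl⟩
  rintro U V hU hV ⟨u, hu⟩ ⟨v, hv⟩
  obtain ⟨ε, hε, hεU⟩ := Metric.isOpen_iff.1 hU u hu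
  obtain ⟨ε', hε', hεV⟩ := Metric.isOpen_iff.1 hV v hv
  obtain ⟨K, hK, hKu⟩ := exists_isCompact_norm_lpRestrict_compl_le hp u (half_pos hε)
  obtain ⟨L, hL, hLv⟩ := exists_isCompact_norm_lpRestrict_compl_le hp v (half_pos hε')
  have key : ∀ {K : Set G} (hK : IsCompact K) (f : WeightedLp μ ω p), ∃ C : ℝ, 0 < C ∧
      ∀ s, ‖T s (lpRestrict _ p hK.measurableSet f)‖ ≤ C * ω s := by
    intro K hK f
    obtain ⟨B, hB, h⟩ := exists_weight_mul_comparable hω hpos hR hK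
    refine ⟨B * (‖f‖ + 1), by positivity, fun s => ?_⟩
    have hs := hpos s
    calc _ ≤ B * ω s * ‖lpRestrict _ p hK.measurableSet f‖ :=
          norm_translation_lpRestrict_le hp hω.measurable hpos hT hK.measurableSet
            (by positivity) (fun t ht => (h s t ht).1) f
      _ ≤ B * ω s * (‖f‖ + 1) := by
          gcongr
          exact (norm_lpRestrict_le _ f).trans (by simp)
      _ = _ := by ring
  obtain ⟨C, hC, hCu⟩ := key hK u
  obtain ⟨D, hD, hDv⟩ := key hL v
  -- The two terms make c⁻¹ T_{s⁻¹} v' smaller than ε/2 and c T_s u' smaller than ε'/2.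
  obtain ⟨s, hs, c, hc, hc0, h1, h2⟩ := h (min (ε / (2 * D)) (ε' / (2 * C))) (by positivity)
  have hc' : 0 < ‖c‖ := norm_pos_iff.2 hc0
  set u' := lpRestrict _ p hK.measurableSet u with hu'
  set v' := lpRestrict _ p hL.measurableSet v with hv'
  have eu : u' + lpRestrict _ p hK.measurableSet.compl u = u := lpRestrict_add_lpRestrict_compl _ u
  have ev : v' + lpRestrict _ p hL.measurableSet.compl v = v := lpRestrict_add_lpRestrict_compl _ v
  refine ⟨(⟨c, hc⟩, ⟨s, hs⟩), u' + c⁻¹ • T s⁻¹ v', hεU ?_, hεV ?_⟩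
  · have e : u' + c⁻¹ • T s⁻¹ v' - u =
        c⁻¹ • T s⁻¹ v' - lpRestrict _ p hK.measurableSet.compl u := by
      calc _ = u' + c⁻¹ • T s⁻¹ v' - (u' + lpRestrict _ p hK.measurableSet.compl u) := by rw [eu]
        _ = _ := by abel
    rw [mem_ball_iff_norm, e]
    have h3 : ‖c⁻¹ • T s⁻¹ v'‖ < ε / 2 := by
      rw [norm_smul, norm_inv, inv_mul_lt_iff₀ hc']
      calc _ ≤ D * ω s⁻¹ := hDv _
        _ < D * (min (ε / (2 * D)) (ε' / (2 * C)) * ‖c‖) := by gcongr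
        _ ≤ D * (ε / (2 * D) * ‖c‖) := by gcongr; exact min_le_left _ _
        _ = _ := by field_simp
    linarith [norm_sub_le (c⁻¹ • T s⁻¹ v') (lpRestrict _ p hK.measurableSet.compl u)]
  · have e : c • T s (u' + c⁻¹ • T s⁻¹ v') - v =
        c • T s u' - lpRestrict _ p hL.measurableSet.compl v := by
      rw [map_add, map_smul, translation_inv_apply hω.measurable hpos hT, smul_add,
        smul_inv_smul₀ hc0]
      calc _ = c • T s u' + v' - (v' + lpRestrict _ p hL.measurableSet.compl v) := by rw [ev]
        _ = _ := by abel
    rw [mem_ball_iff_norm, e]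
    have h3 : ‖c • T s u'‖ < ε' / 2 := by
      rw [norm_smul]
      calc _ ≤ ‖c‖ * (C * ω s) := by gcongr; exact hCu _
        _ = C * (‖c‖ * ω s) := by ring
        _ < C * min (ε / (2 * D)) (ε' / (2 * C)) := by gcongr
        _ ≤ C * (ε' / (2 * C)) := by gcongr; exact min_le_right _ _
        _ = _ := by field_simp
    linarith [norm_sub_le (c • T s u') (lpRestrict _ p hL.measurableSet.compl v)]

end DenseVector

/-! ### Necessity of the criterion -/

section Necessity

variable {G : Type*} [Group G] [TopologicalSpace G] [IsTopologicalGroup G]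
    [T2Space G] [LocallyCompactSpace G] [SecondCountableTopology G]
    [MeasurableSpace G] [BorelSpace G] {μ : Measure G} [μ.IsHaarMeasure]
    {p : ℝ≥0∞} [Fact (1 ≤ p)] {ω : G → ℝ} {S : Set G} {Γ : Set ℂ}

/-- For a given compact set `C`, the vector `u` has arbitrarily small perturbations that are not
approximated by any `c • T s f` with `s ∈ C`. -/
lemma exists_perturbation_forall_notMem [NoncompactSpace G] (hp : p ≠ ∞) (hω : Continuous ω)
    (hpos : ∀ t, 0 < ω t)
    (hM : ∀ s : G, BddAbove (Set.range fun t : G => ω (s * t) / ω t))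
    {T : G → WeightedLp μ ω p →L[ℂ] WeightedLp μ ω p}
    (hT : ∀ s f, T s f =ᵐ[weightedMeasure μ ω p] leftTranslate s f)
    {f : WeightedLp μ ω p} (hf : f ≠ 0) {C K : Set G} (hC : IsCompact C) (hK : IsCompact K)
    {u : WeightedLp μ ω p} (hu : lpRestrict _ p hK.measurableSet u = u) (hu0 : u ≠ 0)
    {η : ℝ} (hη : 0 < η) :
    ∃ w : WeightedLp μ ω p, ‖w‖ = 2 * η ∧
      ∀ s (c : ℂ), ‖c • T s f - (u + w)‖ < η → s ∉ C := by
  have := regular_weightedMeasure (μ := μ) (p := p) hω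
  have hωm := hω.measurable
  obtain ⟨D₁, hD₁, h₁⟩ := exists_mul_left_le_of_isCompact hω hpos hM hC
  obtain ⟨D₂, hD₂, h₂⟩ := exists_mul_left_le_of_isCompact hω hpos hM hC.inv
  have hf' : 0 < ‖f‖ := norm_pos_iff.2 hf
  -- For s ∈ C the inner quotient will bound |c| and D₁ bounds ‖T_s‖, so a tail of f of this size
  -- contributes at most η.
  have hε : 0 < η / (D₁ * (D₂ * (‖u‖ + 3 * η) / ‖f‖)) := by positivity
  obtain ⟨L, hL, hfL⟩ := exists_isCompact_norm_lpRestrict_compl_le hp f hε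
  -- This choice makes xK disjoint from both CL and K.
  obtain ⟨x, hx⟩ : ∃ x, x ∉ (C * L ∪ K) * K⁻¹ :=
    (ne_univ_iff_exists_notMem _).1 (((hC.mul hL).union hK).mul hK.inv).ne_univ
  set xK : Set G := (fun t => x⁻¹ * t) ⁻¹' K with hxK
  have hxKm : MeasurableSet xK := measurable_const_mul _ hK.measurableSet
  have hxu : lpRestrict _ p hxKm (T x u) = T x u := by
    rw [← translation_lpRestrict hωm hpos hT hK.measurableSet hxKm (by simp [hxK]), hu]
  have hxu0 : T x u ≠ 0 := fun h => hu0 (by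
    have := translation_inv_apply hωm hpos hT x⁻¹ u
    rwa [inv_inv, h, map_zero, eq_comm] at this)
  have hxu' : 0 < ‖T x u‖ := norm_pos_iff.2 hxu0
  set w : WeightedLp μ ω p := ((2 * η / ‖T x u‖ : ℝ) : ℂ) • T x u with hw
  have hwn : ‖w‖ = 2 * η := by
    rw [hw, norm_smul, Complex.norm_real, Real.norm_of_nonneg (by positivity)]
    field_simp
  have hxw : lpRestrict _ p hxKm w = w := by rw [hw, map_smul, hxu]
  refine ⟨w, hwn, fun s c hsc hs => ?_⟩
  set h := c • T s f with hh
  have hfT : ‖f‖ ≤ D₂ * ‖T s f‖ := by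
    simpa only [lpRestrict_univ] using norm_lpRestrict_le_norm_translation hp hωm hpos hT
      (s := s) MeasurableSet.univ hD₂.le
      (fun t _ => by simpa using h₂ s⁻¹ (inv_mem_inv.2 hs) (s * t)) f
  have hhn : ‖h‖ ≤ ‖u‖ + 3 * η := by
    have h3 := norm_add_le (h - (u + w)) (u + w)
    rw [sub_add_cancel] at h3
    linarith [norm_add_le u w]
  have hc : ‖c‖ ≤ D₂ * (‖u‖ + 3 * η) / ‖f‖ := by
    rw [le_div_iff₀ hf']
    calc ‖c‖ * ‖f‖ ≤ ‖c‖ * (D₂ * ‖T s f‖) := by gcongr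
      _ = D₂ * ‖h‖ := by rw [hh, norm_smul]; ring
      _ ≤ _ := by gcongr
  have hxKu : lpRestrict _ p hxKm u = 0 := by
    rw [← hu]
    refine lpRestrict_lpRestrict_of_disjoint _ _ (disjoint_left.2 fun t ht htK => hx ?_) _
    exact ⟨t, Or.inr htK, t⁻¹ * x, by simpa [hxK] using ht, by simp⟩
  -- On xK the target u + w is just w, of norm 2η, and h is within η of it.
  have hlow : η < ‖lpRestrict _ p hxKm h‖ := by
    have h4 := (norm_lpRestrict_le hxKm (h - (u + w))).trans_lt hsc
    rw [map_sub, map_add, hxKu, zero_add, hxw] at h4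
    have h5 := norm_sub_norm_le w (lpRestrict _ p hxKm h)
    rw [norm_sub_rev] at h5
    linarith
  refine hlow.not_ge ?_
  -- A = s⁻¹xK misses L, so h on xK only sees the tail of f.
  set A : Set G := (fun t => s * t) ⁻¹' xK with hA
  have hAm : MeasurableSet A := measurable_const_mul _ hxKm
  have hAL : ‖lpRestrict _ p hAm f‖ ≤ η / (D₁ * (D₂ * (‖u‖ + 3 * η) / ‖f‖)) := by
    refine (norm_lpRestrict_le_of_disjoint hAm hL.measurableSet ?_ f).trans hfL
    refine disjoint_left.2 fun t ht htL => hx ?_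
    exact ⟨s * t, Or.inl ⟨s, hs, t, htL, rfl⟩, (s * t)⁻¹ * x, by simpa [hA, hxK] using ht,
      mul_inv_cancel_left _ _⟩
  calc ‖lpRestrict _ p hxKm h‖ = ‖c‖ * ‖T s (lpRestrict _ p hAm f)‖ := by
        rw [translation_lpRestrict hωm hpos hT hAm hxKm (by simp [hA]), hh, map_smul, norm_smul]
    _ ≤ (D₂ * (‖u‖ + 3 * η) / ‖f‖) *
          (D₁ * (η / (D₁ * (D₂ * (‖u‖ + 3 * η) / ‖f‖)))) := by
        gcongr
        refine (norm_translation_lpRestrict_le hp hωm hpos hT hAm hD₁.le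
          (fun t _ => h₁ s hs t) f).trans ?_
        gcongr
    _ = η := by field_simp

lemma exists_small_of_hasDenseVector [NoncompactSpace G] (hp : p ≠ ∞) (hω : Continuous ω)
    (hpos : ∀ t, 0 < ω t)
    (hM : ∀ s : G, BddAbove (Set.range fun t : G => ω (s * t) / ω t))
    (hR : ∀ s : G, BddAbove (Set.range fun t : G => ω (t * s) / ω t))
    (hd : HasDenseVector μ ω p Γ S) {δ : ℝ} (hδ : 0 < δ) :
    ∃ s ∈ S, ∃ c ∈ Γ, c ≠ 0 ∧ ‖c‖ * ω s < δ ∧ ω s⁻¹ < δ * ‖c‖ := by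
  choose T hT using exists_translation (μ := μ) hp hω.measurable hpos hM
  have := regular_weightedMeasure (μ := μ) (p := p) hω
  have hωm := hω.measurable
  obtain ⟨f, hd⟩ := hd
  have hf : f ≠ 0 := by
    rintro rfl
    have := nontrivial_weightedLp (μ := μ) (p := p) hω hpos
    obtain ⟨g, hg⟩ := exists_ne (0 : WeightedLp μ ω p)
    obtain ⟨h, hh, hgh⟩ := hd.exists_dist_lt g (norm_pos_iff.2 hg)
    obtain ⟨c, -, s, -, rfl⟩ := (mem_translateOrbit_iff hT).1 hh
    simp at hgh
  have hf' : 0 < ‖f‖ := norm_pos_iff.2 hf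
  obtain ⟨K, hK, hfK⟩ := exists_isCompact_norm_lpRestrict_compl_le hp f (half_pos hf')
  have hKm := hK.measurableSet
  set u := lpRestrict _ p hKm f with hu
  have huK : lpRestrict _ p hKm u = u := lpRestrict_lpRestrict_of_subset hKm hKm subset_rfl f
  have ha : 0 < ‖u‖ := by
    have h1 := norm_add_le u (lpRestrict _ p hKm.compl f)
    rw [hu, lpRestrict_add_lpRestrict_compl, ← hu] at h1
    linarith
  obtain ⟨B, hB, hBK⟩ := exists_weight_mul_comparable hω hpos hR hK
  -- The first bound leaves |c|‖v‖ > ‖u‖/2 after errors totalling less than 3η; the second absorbs B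
  -- in both final estimates.
  set η := min (‖u‖ / 6) (δ * ‖u‖ / (6 * B)) with hη_def
  have hη : 0 < η := by positivity
  have hη1 : 6 * η ≤ ‖u‖ := by linarith [min_le_left (‖u‖ / 6) (δ * ‖u‖ / (6 * B))]
  have hη2 : 6 * B * η ≤ δ * ‖u‖ := by
    rw [mul_comm, ← le_div_iff₀ (by positivity)]
    exact min_le_right _ _
  obtain ⟨L, hL, hfL⟩ := exists_isCompact_norm_lpRestrict_compl_le hp f hη
  -- For s outside this compact set, K is disjoint from both sL and sK.
  obtain ⟨w, hw, hwC⟩ := exists_perturbation_forall_notMem hp hω hpos hM hT hf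
    (hK.mul (hL.union hK).inv) hK huK (norm_pos_iff.1 ha) hη
  obtain ⟨h, hh, hdist⟩ := hd.exists_dist_lt (u + w) hη
  obtain ⟨c, hc, s, hs, rfl⟩ := (mem_translateOrbit_iff hT).1 hh
  rw [dist_comm, dist_eq_norm] at hdist
  have hsC := hwC s c hdist
  have hs1 := hpos s
  have hs2 := hpos s⁻¹
  have hsmall : ‖c‖ * ω s < δ := by
    set sK : Set G := (fun t => s⁻¹ * t) ⁻¹' K with hsK
    have hsKm : MeasurableSet sK := measurable_const_mul _ hKm
    have hsKu : lpRestrict _ p hsKm u = 0 :=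
      lpRestrict_lpRestrict_of_disjoint _ _ (disjoint_left.2 fun t ht htK => hsC
        ⟨t, htK, t⁻¹ * s, by simpa using Or.inr (by simpa [hsK] using ht), by simp⟩) _
    have h1 : ω s * ‖u‖ ≤ B * ‖T s u‖ := by
      have := norm_lpRestrict_le_norm_translation hp hωm hpos hT (s := s) hKm
        (c := B / ω s) (by positivity) (fun t ht => by
          rw [div_mul_eq_mul_div, le_div_iff₀ hs1, mul_comm]
          exact (hBK s t ht).2) f
      rwa [← hu, div_mul_eq_mul_div, le_div_iff₀ hs1, mul_comm] at this
    have h2 : ‖c • T s u‖ < 3 * η := by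
      have e : c • T s u = lpRestrict _ p hsKm (c • T s f - (u + w)) + lpRestrict _ p hsKm w := by
        rw [map_sub, map_add, hsKu, map_smul,
          ← translation_lpRestrict hωm hpos hT hKm hsKm (by simp [hsK])]
        abel
      rw [e]
      have h3 := norm_add_le (lpRestrict _ p hsKm (c • T s f - (u + w))) (lpRestrict _ p hsKm w)
      have h4 := norm_lpRestrict_le hsKm (c • T s f - (u + w))
      have h5 := norm_lpRestrict_le hsKm w
      linarith
    rw [norm_smul] at h2
    refine lt_of_mul_lt_mul_right ?_ ha.le
    calc ‖c‖ * ω s * ‖u‖ = ‖c‖ * (ω s * ‖u‖) := by ring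
      _ ≤ ‖c‖ * (B * ‖T s u‖) := by gcongr
      _ = B * (‖c‖ * ‖T s u‖) := by ring
      _ < B * (3 * η) := by gcongr
      _ ≤ 6 * B * η := by nlinarith [mul_pos hB hη]
      _ ≤ δ * ‖u‖ := hη2
  have hlarge : ω s⁻¹ < δ * ‖c‖ := by
    -- Here `sK` stands for s⁻¹K; it misses L, so f has norm at most η on it.
    set sK : Set G := (fun t => s * t) ⁻¹' K with hsK
    have hsKm : MeasurableSet sK := measurable_const_mul _ hKm
    have h1 : ‖lpRestrict _ p hsKm f‖ ≤ η :=
      (norm_lpRestrict_le_of_disjoint hsKm hL.measurableSet (disjoint_left.2 fun t ht htL => hsC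
        ⟨s * t, ht, t⁻¹, by simpa using Or.inl htL, by simp⟩) f).trans hfL
    set v := lpRestrict _ p hKm (T s f) with hv
    have h2 : T s⁻¹ v = lpRestrict _ p hsKm f := by
      have e := translation_inv_apply hωm hpos hT s⁻¹ f
      rw [inv_inv] at e
      rw [hv, translation_lpRestrict hωm hpos hT hKm hsKm (by simp [hsK]), e]
    have h3 : ω s⁻¹ * ‖v‖ ≤ B * η := by
      have := norm_lpRestrict_le_norm_translation hp hωm hpos hT (s := s⁻¹) hKm
        (c := B / ω s⁻¹) (by positivity) (fun t ht => by
          rw [div_mul_eq_mul_div, le_div_iff₀ hs2, mul_comm]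
          exact (hBK s⁻¹ t ht).2) (T s f)
      rw [← hv, div_mul_eq_mul_div, le_div_iff₀ hs2, mul_comm, h2] at this
      exact this.trans (by gcongr)
    have h4 : ‖u‖ / 2 < ‖c‖ * ‖v‖ := by
      have e : u = c • v - lpRestrict _ p hKm (c • T s f - (u + w)) - lpRestrict _ p hKm w := by
        rw [map_sub, map_add, huK, map_smul]
        abel
      have h5 := norm_sub_le (c • v - lpRestrict _ p hKm (c • T s f - (u + w)))
        (lpRestrict _ p hKm w)
      have h6 := norm_sub_le (c • v) (lpRestrict _ p hKm (c • T s f - (u + w)))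
      have h7 := norm_lpRestrict_le hKm (c • T s f - (u + w))
      have h8 := norm_lpRestrict_le hKm w
      rw [← e] at h5
      rw [norm_smul] at h6
      linarith
    have hc0 : 0 < ‖c‖ := pos_of_mul_pos_left ((half_pos ha).trans h4) (norm_nonneg v)
    refine lt_of_mul_lt_mul_right (a := ‖u‖ / 2) ?_ (half_pos ha).le
    calc ω s⁻¹ * (‖u‖ / 2) < ω s⁻¹ * (‖c‖ * ‖v‖) := by gcongr
      _ = ‖c‖ * (ω s⁻¹ * ‖v‖) := by ring
      _ ≤ ‖c‖ * (B * η) := by gcongr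
      _ ≤ ‖c‖ * (δ * ‖u‖ / 2) := by
          gcongr
          nlinarith [mul_pos hB hη]
      _ = _ := by ring
  refine ⟨s, hs, c, hc, ?_, hsmall, hlarge⟩
  rintro rfl
  rw [norm_zero, mul_zero] at hlarge
  exact hs2.not_gt hlarge

lemma hasDenseVector_iff [NoncompactSpace G] (hp : p ≠ ∞) (hω : Continuous ω)
    (hpos : ∀ t, 0 < ω t)
    (hM : ∀ s : G, BddAbove (Set.range fun t : G => ω (s * t) / ω t))
    (hR : ∀ s : G, BddAbove (Set.range fun t : G => ω (t * s) / ω t)) :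
    HasDenseVector μ ω p Γ S ↔
      ∀ δ > 0, ∃ s ∈ S, ∃ c ∈ Γ, c ≠ 0 ∧ ‖c‖ * ω s < δ ∧ ω s⁻¹ < δ * ‖c‖ :=
  ⟨fun h _ hδ => exists_small_of_hasDenseVector hp hω hpos hM hR h hδ,
    hasDenseVector_of_exists_small hp hω hpos hM hR⟩

end Necessity

/-- In ℝ the empty set has no greatest lower bound, so `IsGLB` agrees with the convention inf ∅ =
+∞. -/
lemma isGLB_image_zero_iff {α : Type*} {φ : α → ℝ} (hφ : ∀ a, 0 ≤ φ a) (S : Set α) :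
    IsGLB (φ '' S) 0 ↔ ∀ ε > 0, ∃ s ∈ S, φ s < ε := by
  have h0 : (0 : ℝ) ∈ lowerBounds (φ '' S) := by
    rintro _ ⟨a, -, rfl⟩
    exact hφ a
  constructor
  · intro h ε hε
    obtain ⟨_, ⟨s, hs, rfl⟩, -, h2⟩ := h.exists_between hε
    exact ⟨s, hs, h2⟩
  · refine fun h => ⟨h0, fun b hb => le_of_forall_pos_lt_add fun ε hε => ?_⟩
    obtain ⟨s, hs, h1⟩ := h ε hε
    linarith [hb (mem_image_of_mem φ hs)]

/-! ### From the criterion to the four infima -/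

section WeightInfimum

variable {G : Type*} [Group G] {ω : G → ℝ} {S : Set G} {Γ : Set ℂ}

lemma exists_small_iff_isGLB_max (hpos : ∀ t, 0 < ω t) (hΓ : (Γ \ {0}).Nonempty)
    (hb : Bornology.IsBounded (Γ \ {0})) (hb' : ∃ c : ℝ, 0 < c ∧ ∀ z ∈ Γ \ {0}, c ≤ ‖z‖) :
    (∀ δ > 0, ∃ s ∈ S, ∃ c ∈ Γ, c ≠ 0 ∧ ‖c‖ * ω s < δ ∧ ω s⁻¹ < δ * ‖c‖) ↔
      IsGLB ((fun s : G => max (ω s) (ω s⁻¹)) '' S) 0 := by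
  rw [isGLB_image_zero_iff fun s => le_max_of_le_left (hpos s).le]
  constructor
  · obtain ⟨m, hm, hmΓ⟩ := hb'
    obtain ⟨M, hM, hMΓ⟩ := hb.exists_pos_norm_le
    intro h ε hε
    obtain ⟨s, hs, c, hc, hc0, h1, h2⟩ := h (min (m * ε) (ε / M)) (by positivity)
    refine ⟨s, hs, max_lt ?_ ?_⟩
    · have h3 := h1.trans_le (min_le_left _ _)
      have h4 := hmΓ c ⟨hc, hc0⟩
      exact lt_of_mul_lt_mul_left
        ((mul_le_mul_of_nonneg_right h4 (hpos s).le).trans_lt h3) hm.le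
    · calc ω s⁻¹ < min (m * ε) (ε / M) * ‖c‖ := h2
        _ ≤ ε / M * M := by
            gcongr
            · exact min_le_right _ _
            · exact hMΓ c ⟨hc, hc0⟩
        _ = ε := by field_simp
  · obtain ⟨c, hc, hc0⟩ := hΓ
    have hc' : 0 < ‖c‖ := norm_pos_iff.2 hc0
    intro h δ hδ
    obtain ⟨s, hs, h1⟩ := h (min (δ / ‖c‖) (δ * ‖c‖)) (by positivity)
    obtain ⟨h2, h3⟩ := max_lt_iff.1 h1
    refine ⟨s, hs, c, hc, hc0, ?_, h3.trans_le (min_le_right _ _)⟩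
    rw [mul_comm, ← lt_div_iff₀ hc']
    exact h2.trans_le (min_le_left _ _)

lemma mul_lt_sq_of_small {a b δ r : ℝ} (ha : 0 < a) (hb : 0 < b) (hδ : 0 < δ) (h1 : r * a < δ)
    (h2 : b < δ * r) : a * b < δ ^ 2 := by
  have hr : 0 < r := pos_of_mul_pos_right (hb.trans h2) hδ.le
  calc a * b < a * (δ * r) := by gcongr
    _ = δ * (r * a) := by ring
    _ < δ * δ := by gcongr
    _ = δ ^ 2 := by ring

lemma exists_small_Icc_iff_isGLB (hpos : ∀ t, 0 < ω t) :
    (∀ δ > 0, ∃ s ∈ S, ∃ c ∈ (fun x : ℝ => (x : ℂ)) '' Icc 0 1,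
      c ≠ 0 ∧ ‖c‖ * ω s < δ ∧ ω s⁻¹ < δ * ‖c‖) ↔
      IsGLB ((fun s : G => max (ω s * ω s⁻¹) (ω s⁻¹)) '' S) 0 := by
  rw [isGLB_image_zero_iff fun s => le_max_of_le_right (hpos _).le]
  constructor
  · intro h ε hε
    -- Capping at 1 ensures δ² ≤ ε for the product term.
    obtain ⟨s, hs, _, ⟨r, ⟨hr0, hr1⟩, rfl⟩, -, h1, h2⟩ := h (min ε 1) (by positivity)
    rw [Complex.norm_real, Real.norm_of_nonneg hr0] at h1 h2
    refine ⟨s, hs, max_lt ?_ ?_⟩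
    · refine (mul_lt_sq_of_small (hpos _) (hpos _) (by positivity) h1 h2).trans_le ?_
      nlinarith [min_le_left ε 1, min_le_right ε 1, lt_min hε one_pos]
    · nlinarith [min_le_left ε 1, lt_min hε one_pos]
  · intro h δ hδ
    obtain ⟨s, hs, h1⟩ := h (min (δ ^ 2) δ) (by positivity)
    obtain ⟨h2, h3⟩ := max_lt_iff.1 h1
    have hs1 := hpos s
    have hs2 := hpos s⁻¹
    -- The product term of the maximum gives ω(s⁻¹)/δ < δ/ω(s); the other term leaves room below 1.
    obtain ⟨r, hr1, hr2⟩ : ∃ r, ω s⁻¹ / δ < r ∧ r < min 1 (δ / ω s) := by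
      refine exists_between (lt_min ?_ ?_)
      · rw [div_lt_one hδ]
        exact h3.trans_le (min_le_right _ _)
      · rw [div_lt_div_iff₀ hδ hs1]
        nlinarith [h2.trans_le (min_le_left _ _)]
    have hr0 : 0 < r := lt_trans (by positivity) hr1
    refine ⟨s, hs, r, ⟨r, ⟨hr0.le, (hr2.trans_le (min_le_left _ _)).le⟩, rfl⟩, ?_⟩
    rw [Complex.norm_real, Real.norm_of_nonneg hr0.le]
    refine ⟨Complex.ofReal_ne_zero.2 hr0.ne', ?_, ?_⟩
    · exact (lt_div_iff₀ hs1).1 (hr2.trans_le (min_le_right _ _))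
    · exact (div_lt_iff₀' hδ).1 hr1

lemma exists_small_Ici_iff_isGLB (hpos : ∀ t, 0 < ω t) :
    (∀ δ > 0, ∃ s ∈ S, ∃ c ∈ (fun x : ℝ => (x : ℂ)) '' Ici 1,
      c ≠ 0 ∧ ‖c‖ * ω s < δ ∧ ω s⁻¹ < δ * ‖c‖) ↔
      IsGLB ((fun s : G => max (ω s * ω s⁻¹) (ω s)) '' S) 0 := by
  rw [isGLB_image_zero_iff fun s => le_max_of_le_right (hpos _).le]
  constructor
  · intro h ε hε
    obtain ⟨s, hs, _, ⟨r, hr1, rfl⟩, -, h1, h2⟩ := h (min ε 1) (by positivity)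
    have hr1' : (1 : ℝ) ≤ r := hr1
    rw [Complex.norm_real, Real.norm_of_nonneg (by positivity)] at h1 h2
    refine ⟨s, hs, max_lt ?_ ?_⟩
    · refine (mul_lt_sq_of_small (hpos _) (hpos _) (by positivity) h1 h2).trans_le ?_
      nlinarith [min_le_left ε 1, min_le_right ε 1, lt_min hε one_pos]
    · nlinarith [min_le_left ε 1, hpos s]
  · intro h δ hδ
    obtain ⟨s, hs, h1⟩ := h (min (δ ^ 2) δ) (by positivity)
    obtain ⟨h2, h3⟩ := max_lt_iff.1 h1
    have hs1 := hpos s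
    have hs2 := hpos s⁻¹
    -- Now ω(s) < δ leaves room above 1.
    obtain ⟨r, hr1, hr2⟩ : ∃ r, max 1 (ω s⁻¹ / δ) < r ∧ r < δ / ω s := by
      refine exists_between (max_lt ?_ ?_)
      · rw [one_lt_div hs1]
        exact h3.trans_le (min_le_right _ _)
      · rw [div_lt_div_iff₀ hδ hs1]
        nlinarith [h2.trans_le (min_le_left _ _)]
    have hr1' : 1 < r := (le_max_left _ _).trans_lt hr1
    have hr0 : 0 < r := one_pos.trans hr1'
    refine ⟨s, hs, r, ⟨r, hr1'.le, rfl⟩, ?_⟩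
    rw [Complex.norm_real, Real.norm_of_nonneg hr0.le]
    refine ⟨Complex.ofReal_ne_zero.2 hr0.ne', (lt_div_iff₀ hs1).1 hr2, ?_⟩
    exact (div_lt_iff₀' hδ).1 ((le_max_right _ _).trans_lt hr1)

lemma exists_small_univ_iff_isGLB (hpos : ∀ t, 0 < ω t) :
    (∀ δ > 0, ∃ s ∈ S, ∃ c ∈ (univ : Set ℂ), c ≠ 0 ∧ ‖c‖ * ω s < δ ∧ ω s⁻¹ < δ * ‖c‖) ↔
      IsGLB ((fun s : G => ω s * ω s⁻¹) '' S) 0 := by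
  rw [isGLB_image_zero_iff fun s => (mul_pos (hpos _) (hpos _)).le]
  constructor
  · intro h ε hε
    obtain ⟨s, hs, c, -, -, h1, h2⟩ := h (min ε 1) (by positivity)
    refine ⟨s, hs, (mul_lt_sq_of_small (hpos _) (hpos _) (by positivity) h1 h2).trans_le ?_⟩
    nlinarith [min_le_left ε 1, min_le_right ε 1, lt_min hε one_pos]
  · intro h δ hδ
    obtain ⟨s, hs, h1⟩ := h (δ ^ 2) (by positivity)
    have hs1 := hpos s
    have hs2 := hpos s⁻¹
    obtain ⟨r, hr1, hr2⟩ : ∃ r, ω s⁻¹ / δ < r ∧ r < δ / ω s := by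
      refine exists_between ?_
      rw [div_lt_div_iff₀ hδ hs1]
      nlinarith
    have hr0 : 0 < r := lt_trans (by positivity) hr1
    refine ⟨s, hs, r, mem_univ _, ?_⟩
    rw [Complex.norm_real, Real.norm_of_nonneg hr0.le]
    exact ⟨Complex.ofReal_ne_zero.2 hr0.ne', (lt_div_iff₀ hs1).1 hr2, (div_lt_iff₀' hδ).1 hr1⟩

end WeightInfimum

theorem corollary29 {G : Type*} [Group G] [TopologicalSpace G] [IsTopologicalGroup G]
    [T2Space G] [LocallyCompactSpace G] [SecondCountableTopology G] [NoncompactSpace G]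
    [MeasurableSpace G] [BorelSpace G] (μ : Measure G) [μ.IsHaarMeasure]
    (S : Set G) (p : ℝ≥0∞) [Fact (1 ≤ p)] (hp : p ≠ ∞) (ω : G → ℝ)
    (Γ : Set ℂ) (hΓ : (Γ \ {0}).Nonempty)
    (hω : IsWeight μ ω p) (hS : IsAdmissibleWeight μ S ω)
    (hcont : Continuous ω)
    (hM : ∀ s : G, BddAbove (Set.range fun t : G => ω (s * t) / ω t))
    (hR : ∀ s : G, BddAbove (Set.range fun t : G => ω (t * s) / ω t)) :
    (Bornology.IsBounded (Γ \ {0}) → (∃ c : ℝ, 0 < c ∧ ∀ z ∈ Γ \ {0}, c ≤ ‖z‖) →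
      (HasDenseVector μ ω p Γ S ↔
        IsGLB ((fun s : G => max (ω s) (ω s⁻¹)) '' S) 0)) ∧
    (HasDenseVector μ ω p ((fun x : ℝ => (x : ℂ)) '' Set.Icc 0 1) S ↔
      IsGLB ((fun s : G => max (ω s * ω s⁻¹) (ω s⁻¹)) '' S) 0) ∧
    (HasDenseVector μ ω p ((fun x : ℝ => (x : ℂ)) '' Set.Ici 1) S ↔
      IsGLB ((fun s : G => max (ω s * ω s⁻¹) (ω s)) '' S) 0) ∧
    (HasDenseVector μ ω p Set.univ S ↔
      IsGLB ((fun s : G => ω s * ω s⁻¹) '' S) 0) := by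
  have hpos := hω.pos
  simp only [hasDenseVector_iff hp hcont hpos hM hR]
  exact ⟨exists_small_iff_isGLB_max hpos hΓ, exists_small_Icc_iff_isGLB hpos,
    exists_small_Ici_iff_isGLB hpos, exists_small_univ_iff_isGLB hpos⟩
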